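/- For $n\ge 1$ let $\mathcal G_n$ be the set of pairs $(G,(a_1,\dots,a_n))$, where $G$ is a group generated by $a_1,\dots,a_n$, with $(G,(a_i))$ and $(H,(b_i))$ identified if $a_i\mapsto b_i$ $(i=1,\dots,n)$ extends to an isomorphism $G\to H$. Give $\mathcal G_n$ the topology in which a base of neighborhoods of $(G,(a_i))$ is formed by the sets $W_r$, $r\in\mathbb N$, of all $(H,(b_i))$ such that for every element $w$ of length at most $r$ of the free group $F_n$ one has $w(b_1,\dots,b_n)=1$ in $H$ if and only if $w(a_1,\dots,a_n)=1$ in $G$. Let $\mathcal G=\bigcup_{n\ge 1}\mathcal G_n$ be the topological union (direct limit) along the embeddings $\mathcal G_n\to\mathcal G_{n+1}$, $(G,(a_1,\dots,a_n))\mapsto (G,(a_1,\dots,a_n,1))$. A finitely generated group $G$ is called \emph{condensed} if its isomorphism class $[G]=\{(H,B)\in\mathcal G\mid H\cong G\}$ has no isolated points, i.e. every point of $[G]$ is an accumulation point of $[G]$ in $\mathcal G$. Write $x^y=y^{-1}xy$, and let $[x,y]$ denote the commutator of $x$ and $y$. \textbf{Corollary.} The group $$ E=\left\langle a,b,c,h,s,t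 \;\left|\; \begin{array}{c} [a,h]=1,\;\, [b,h]=1,\;\, [c,h]=1,\\ a^2=1,\;\, [a,a^b]=1,\;\, [b,c]=1,\;\, a^c=aa^b,\\ (h^2)^s=ha,\;\, (h^2)^t=h^2 \end{array}\right.\right\rangle $$ is finitely presented and condensed. -/

import Mathlib

namespace CondensedGroups

/-! ### Marked groups -/

/-- A group together with an ordered `n`-tuple of elements generating it. Finitely generated groups
are countable, so groups in `Type` represent all of them up to isomorphism. -/
structure MarkedPair (n : ℕ) where
  /-- The underlying group. -/
  carrier : Type
  /-- The group structure. -/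
  [group : Group carrier]
  /-- The generating tuple. -/
  gens : Fin n → carrier
  closure_range_gens : Subgroup.closure (Set.range gens) = ⊤

attribute [instance] MarkedPair.group

/-- `(G, A)` and `(H, B)` are equivalent if `aᵢ ↦ bᵢ` extends to an isomorphism `G → H`. -/
instance MarkedPair.setoid (n : ℕ) : Setoid (MarkedPair n) where
  r P Q := ∃ e : P.carrier ≃* Q.carrier, ∀ i, e (P.gens i) = Q.gens i
  iseqv :=
    { refl := fun P => ⟨MulEquiv.refl _, fun _ => rfl⟩
      symm := by
        rintro P Q ⟨e, he⟩
        exact ⟨e.symm, fun i => by rw [← he i, MulEquiv.symm_apply_apply]⟩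
      trans := by
        rintro P Q R ⟨e, he⟩ ⟨f, hf⟩
        exact ⟨e.trans f, fun i => by rw [MulEquiv.trans_apply, he i, hf i]⟩ }

/-- The set `𝒢ₙ` of `n`-generated marked groups. -/
def MarkedGroup (n : ℕ) : Type 1 := Quotient (MarkedPair.setoid n)

/-- The set of all `w ∈ Fₙ` with `w(a₁, …, aₙ) = 1`. -/
def MarkedPair.relators {n : ℕ} (P : MarkedPair n) : Set (FreeGroup (Fin n)) :=
  {w | FreeGroup.lift P.gens w = 1}

theorem MarkedPair.relators_congr {n : ℕ} {P Q : MarkedPair n} (h : P ≈ Q) :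
    P.relators = Q.relators := by
  obtain ⟨e, he⟩ := h
  have key : e.toMonoidHom.comp (FreeGroup.lift P.gens) = FreeGroup.lift Q.gens := by
    ext i
    simp [he]
  ext w
  change FreeGroup.lift P.gens w = 1 ↔ FreeGroup.lift Q.gens w = 1
  rw [← key]
  simp

/-- The set of all words in `Fₙ` that are trivial in a marked group. -/
def MarkedGroup.relators {n : ℕ} (x : MarkedGroup n) : Set (FreeGroup (Fin n)) :=
  Quotient.lift MarkedPair.relators (fun _ _ h => MarkedPair.relators_congr h) x

/-- The relation `(G, A) ≅ᵣ (H, B)`: the same words of length at most `r` are trivial. -/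
def MarkedGroup.CongrUpTo {n : ℕ} (r : ℕ) (x y : MarkedGroup n) : Prop :=
  ∀ w : FreeGroup (Fin n), w.norm ≤ r → (w ∈ x.relators ↔ w ∈ y.relators)

/-- The basic neighbourhood `W(r, x)` of `x` in `𝒢ₙ`. -/
def MarkedGroup.nbhd {n : ℕ} (r : ℕ) (x : MarkedGroup n) : Set (MarkedGroup n) :=
  {y | MarkedGroup.CongrUpTo r y x}

/-- The topology of `𝒢ₙ`, with the sets `W(r, x)` as a base of neighbourhoods of `x`. -/
instance MarkedGroup.topologicalSpace (n : ℕ) : TopologicalSpace (MarkedGroup n) where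
  IsOpen U := ∀ x ∈ U, ∃ r : ℕ, MarkedGroup.nbhd r x ⊆ U
  isOpen_univ := fun _ _ => ⟨0, Set.subset_univ _⟩
  isOpen_inter := by
    intro U V hU hV x hx
    obtain ⟨r, hr⟩ := hU x hx.1
    obtain ⟨s, hs⟩ := hV x hx.2
    refine ⟨max r s, fun y hy => ⟨hr fun w hw => hy w ?_, hs fun w hw => hy w ?_⟩⟩
    · exact hw.trans (le_max_left _ _)
    · exact hw.trans (le_max_right _ _)
  isOpen_sUnion := by
    intro S hS x hx
    obtain ⟨U, hU, hxU⟩ := hx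
    obtain ⟨r, hr⟩ := hS U hU x hxU
    exact ⟨r, hr.trans (Set.subset_sUnion_of_mem hU)⟩

/-! ### The space of finitely generated marked groups -/

/-- `(G, (a₁, …, aₙ)) ↦ (G, (a₁, …, aₙ, 1))` on pairs. -/
def MarkedPair.snocOne {n : ℕ} (P : MarkedPair n) : MarkedPair (n + 1) where
  carrier := P.carrier
  gens := Fin.snoc (α := fun _ => P.carrier) P.gens 1
  closure_range_gens := by
    rw [eq_top_iff, ← P.closure_range_gens]
    apply Subgroup.closure_mono
    rintro _ ⟨i, rfl⟩
    exact ⟨i.castSucc, Fin.snoc_castSucc (α := fun _ => P.carrier) _ _ _⟩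

theorem MarkedPair.snocOne_congr {n : ℕ} {P Q : MarkedPair n} (h : P ≈ Q) :
    P.snocOne ≈ Q.snocOne := by
  obtain ⟨e, he⟩ := h
  refine ⟨e, fun i => ?_⟩
  refine Fin.lastCases ?_ (fun j => ?_) i
  · change e (Fin.snoc (α := fun _ => P.carrier) P.gens 1 (Fin.last n)) =
      Fin.snoc (α := fun _ => Q.carrier) Q.gens 1 (Fin.last n)
    rw [Fin.snoc_last, Fin.snoc_last, map_one]
  · change e (Fin.snoc (α := fun _ => P.carrier) P.gens 1 j.castSucc) =
      Fin.snoc (α := fun _ => Q.carrier) Q.gens 1 j.castSucc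
    rw [Fin.snoc_castSucc, Fin.snoc_castSucc, he j]

/-- The embedding `𝒢ₙ → 𝒢ₙ₊₁`, `(G, (a₁, …, aₙ)) ↦ (G, (a₁, …, aₙ, 1))`. -/
def MarkedGroup.snocOne {n : ℕ} : MarkedGroup n → MarkedGroup (n + 1) :=
  Quotient.map MarkedPair.snocOne fun _ _ h => MarkedPair.snocOne_congr h

/-- The identification of a point of `𝒢ₙ` with its image in `𝒢ₙ₊₁`, for `n ≥ 1`. -/
inductive Identified : (Σ n : ℕ, MarkedGroup (n + 1)) → (Σ n : ℕ, MarkedGroup (n + 1)) → Prop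
  | step (n : ℕ) (x : MarkedGroup (n + 1)) : Identified ⟨n, x⟩ ⟨n + 1, x.snocOne⟩

/-- The space `𝒢` of finitely generated marked groups: the union of the increasing sequence
`𝒢₁ → 𝒢₂ → ⋯`, that is, the quotient of the disjoint union of the `𝒢ₙ`, `n ≥ 1`, by the equivalence
relation generated by the above identifications. -/
def MarkedGroups : Type 1 := Quot Identified

/-- The topology of the topological union (the quotient topology of the disjoint union): a set is
open if and only if its preimage in every `𝒢ₙ` is open. -/
instance MarkedGroups.topologicalSpace : TopologicalSpace MarkedGroups :=
  inferInstanceAs (TopologicalSpace (Quot Identified))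

/-- The point of `𝒢` given by a group with a nonempty finite generating tuple. -/
def MarkedGroups.mk {n : ℕ} (P : MarkedPair (n + 1)) : MarkedGroups :=
  Quot.mk Identified ⟨n, Quotient.mk (MarkedPair.setoid (n + 1)) P⟩

/-- The isomorphism class `[G] = {(H, B) ∈ 𝒢 | H ≅ G}`. -/
def isoClass (G : Type*) [Group G] : Set MarkedGroups :=
  {x | ∃ (n : ℕ) (P : MarkedPair (n + 1)), Nonempty (P.carrier ≃* G) ∧ x = MarkedGroups.mk P}

/-- A finitely generated group `G` is condensed if `[G]` has no isolated points, i.e. every point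
of `[G]` is an accumulation point of `[G]` in `𝒢`. -/
structure IsCondensed (G : Type*) [Group G] : Prop where
  fg : Group.FG G
  preperfect : Preperfect (isoClass G)

/-! ### The group `E` -/

/-- The six generators. -/
inductive Gen : Type
  | a | b | c | h | s | t

/-- `x ^ y = y⁻¹ x y`. -/
def conj {G : Type*} [Group G] (x y : G) : G := y⁻¹ * x * y

/-- The word whose triviality expresses the relation `x = y`. -/
def rel {G : Type*} [Group G] (x y : G) : G := x * y⁻¹

open scoped commutatorElement in
/-- The defining relations of `E`, as words in the free group on `a, b, c, h, s, t`. -/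
def relatorsE : Set (FreeGroup Gen) :=
  let a := FreeGroup.of Gen.a
  let b := FreeGroup.of Gen.b
  let c := FreeGroup.of Gen.c
  let h := FreeGroup.of Gen.h
  let s := FreeGroup.of Gen.s
  let t := FreeGroup.of Gen.t
  { ⁅a, h⁆, ⁅b, h⁆, ⁅c, h⁆,
    rel (a ^ 2) 1, ⁅a, conj a b⁆, ⁅b, c⁆, rel (conj a c) (a * conj a b),
    rel (conj (h ^ 2) s) (h * a), rel (conj (h ^ 2) t) (h ^ 2) }

/-- The group `E`. -/
abbrev E : Type := PresentedGroup relatorsE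

end CondensedGroups

namespace CondensedGroups

open Subgroup
open scoped commutatorElement

/-! ### A criterion for being condensed -/

/-! If f is a surjective, non-injective endomorphism of G, then (f(a₁), …, f(aₙ)) is another
generating tuple of G, with strictly more relators. It is close to (a₁, …, aₙ) once f kills no
nontrivial value of a short word. So G is condensed if every finite set of nontrivial elements is
avoided by the kernel of such an f (`isCondensed_of_surjective_endomorphisms`).

For E, the letter t is the stable letter of an HNN extension of `Base` = ⟨a, b, c, h, s⟩
centralizing h². Since h commutes with a and b, each rᵢ = h·a^(bⁱ) is a square root of h², and rᵢ is
also the conjugate of h² by s·bⁱ. Making t centralize rᵢ instead of h² is therefore a proper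
quotient of E (`root_sq`, `proj_not_injective`) that is again isomorphic to E (`conj_h_sq`,
`conjEquiv`). Distinct groups ⟨rᵢ⟩ meet only in ⟨h²⟩ (`eq_of_mem_zpowers_root`), so by Britton's
lemma a nontrivial element dies in only finitely many of these quotients
(`finite_setOf_proj_eq_one`), and some i serves any given finite set.

That the rᵢ really differ in `Base` is seen in an HNN extension of a group of affine maps over 𝔽₂(X)
times ℤ, where a^(bⁱ) becomes translation by Xⁱ. -/

/-- A generating tuple padded with `1` to an infinite sequence. -/
def MarkedPair.extendGens {n : ℕ} (P : MarkedPair n) (i : ℕ) : P.carrier :=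
  if h : i < n then P.gens ⟨i, h⟩ else 1

theorem MarkedPair.extendGens_snocOne {n : ℕ} (P : MarkedPair n) :
    P.snocOne.extendGens = P.extendGens := by
  funext i
  change (if h : i < n + 1 then Fin.snoc (α := fun _ => P.carrier) P.gens 1 ⟨i, h⟩ else 1) =
    if h : i < n then P.gens ⟨i, h⟩ else 1
  simp only [Fin.snoc]
  split_ifs <;> first | rfl | omega

/-- The words in infinitely many letters that are trivial in a padded marked group. -/
def MarkedPair.stableRelators {n : ℕ} (P : MarkedPair n) : Set (FreeGroup ℕ) :=
  {w | FreeGroup.lift P.extendGens w = 1}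

theorem MarkedPair.stableRelators_snocOne {n : ℕ} (P : MarkedPair n) :
    P.snocOne.stableRelators = P.stableRelators := by
  ext w
  change FreeGroup.lift P.snocOne.extendGens w = 1 ↔ FreeGroup.lift P.extendGens w = 1
  rw [P.extendGens_snocOne]
  rfl

theorem MarkedPair.stableRelators_congr {n : ℕ} {P Q : MarkedPair n} (h : P ≈ Q) :
    P.stableRelators = Q.stableRelators := by
  obtain ⟨e, he⟩ := h
  have key : e.toMonoidHom.comp (FreeGroup.lift P.extendGens) = FreeGroup.lift Q.extendGens := by
    ext i
    by_cases hi : i < n <;> simp [MarkedPair.extendGens, hi, he]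
  ext w
  change FreeGroup.lift P.extendGens w = 1 ↔ FreeGroup.lift Q.extendGens w = 1
  rw [← key]
  simp

/-- The stable relators of a point of the space of finitely generated marked groups. -/
def MarkedGroups.stableRelators : MarkedGroups → Set (FreeGroup ℕ) :=
  Quot.lift
    (fun x => Quotient.lift MarkedPair.stableRelators
      (fun _ _ h => MarkedPair.stableRelators_congr h) x.2)
    (by
      rintro _ _ ⟨n, x⟩
      induction x using Quotient.inductionOn with
      | h P => exact P.stableRelators_snocOne.symm)

theorem MarkedPair.mem_relators_iff_map_mem_stableRelators {n : ℕ} (P : MarkedPair n)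
    (w : FreeGroup (Fin n)) :
    w ∈ P.relators ↔ FreeGroup.map (fun i : Fin n => (i : ℕ)) w ∈ P.stableRelators := by
  have key : (FreeGroup.lift P.extendGens).comp (FreeGroup.map fun i : Fin n => (i : ℕ)) =
      FreeGroup.lift P.gens := by
    ext i
    simp [MarkedPair.extendGens]
  change FreeGroup.lift P.gens w = 1 ↔ _
  rw [← key]
  rfl

/-- Equality in 𝒢 is generated by identifications across different n, so it is tested by an
invariant that padding with 1 leaves unchanged. This is what shows the approximating points to be
different from the given one. -/
theorem MarkedPair.relators_eq_of_mk_eq {n : ℕ} {P Q : MarkedPair (n + 1)}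
    (h : MarkedGroups.mk P = MarkedGroups.mk Q) : P.relators = Q.relators := by
  have hs : P.stableRelators = Q.stableRelators := congrArg MarkedGroups.stableRelators h
  ext w
  rw [P.mem_relators_iff_map_mem_stableRelators, Q.mem_relators_iff_map_mem_stableRelators, hs]

theorem MarkedPair.lift_gens_surjective {n : ℕ} (P : MarkedPair n) :
    Function.Surjective (FreeGroup.lift P.gens) := by
  rw [← MonoidHom.range_eq_top, FreeGroup.range_lift_eq_closure, P.closure_range_gens]

/-- The image of a marked group under a surjective homomorphism. -/
def MarkedPair.map {n : ℕ} (P : MarkedPair n) {H : Type} [Group H] (f : P.carrier →* H)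
    (hf : Function.Surjective f) : MarkedPair n where
  carrier := H
  gens := fun i => f (P.gens i)
  closure_range_gens := by
    rw [Set.range_comp' f P.gens, ← MonoidHom.map_closure, P.closure_range_gens,
      Subgroup.map_top_of_surjective f hf]

theorem MarkedPair.mem_relators_map {n : ℕ} (P : MarkedPair n) {H : Type} [Group H]
    (f : P.carrier →* H) (hf : Function.Surjective f) (w : FreeGroup (Fin n)) :
    w ∈ (P.map f hf).relators ↔ f (FreeGroup.lift P.gens w) = 1 := by
  have key : f.comp (FreeGroup.lift P.gens) = FreeGroup.lift fun i => f (P.gens i) := by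
    ext i
    simp
  change FreeGroup.lift (fun i => f (P.gens i)) w = 1 ↔ _
  rw [← key]
  rfl

theorem finite_setOf_norm_le {α : Type*} [Finite α] [DecidableEq α] (r : ℕ) :
    {w : FreeGroup α | w.norm ≤ r}.Finite :=
  (List.finite_length_le (α × Bool) r).preimage FreeGroup.toWord_injective.injOn

/-- A finitely generated group is condensed if no finite set of nontrivial elements meets the kernel
of every non-injective surjective endomorphism. -/
theorem isCondensed_of_surjective_endomorphisms (G : Type*) [Group G] (hG : Group.FG G)
    (hend : ∀ S : Set G, S.Finite → 1 ∉ S → ∃ f : G →* G, Function.Surjective f ∧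
      ¬ Function.Injective f ∧ ∀ g ∈ S, f g ≠ 1) : IsCondensed G := by
  refine ⟨hG, ?_⟩
  rintro _ ⟨n, P, ⟨e⟩, rfl⟩
  rw [accPt_iff_nhds]
  intro U hU
  obtain ⟨V, hVU, hV, hPV⟩ := mem_nhds_iff.mp hU
  have hcont : Continuous fun x : MarkedGroup (n + 1) =>
      (Quot.mk Identified ⟨n, x⟩ : MarkedGroups) :=
    continuous_quot_mk.comp continuous_sigmaMk
  obtain ⟨r, hr⟩ := (hV.preimage hcont) (Quotient.mk (MarkedPair.setoid (n + 1)) P) hPV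
  let S : Set G := ((fun w => e (FreeGroup.lift P.gens w)) ''
    {w : FreeGroup (Fin (n + 1)) | w.norm ≤ r}) \ {1}
  obtain ⟨f, hf, hfi, hfS⟩ := hend S (((finite_setOf_norm_le r).image _).sdiff) (by simp [S])
  let φ : P.carrier →* P.carrier := (e.symm.toMonoidHom.comp f).comp e.toMonoidHom
  have hφ : Function.Surjective φ := (e.symm.surjective.comp hf).comp e.surjective
  have hφ_one : ∀ x, φ x = 1 ↔ f (e x) = 1 := by
    intro x
    simp [φ]
  refine ⟨MarkedGroups.mk (P.map φ hφ), ⟨hVU (hr ?_), n, P.map φ hφ, ⟨e⟩, rfl⟩, ?_⟩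
  · intro w hw
    change w ∈ (P.map φ hφ).relators ↔ FreeGroup.lift P.gens w = 1
    rw [P.mem_relators_map, hφ_one]
    constructor
    · intro h
      by_contra hne
      exact hfS _ ⟨⟨w, hw, rfl⟩, by simpa using hne⟩ h
    · intro h
      rw [h, map_one, map_one]
  · intro heq
    apply hfi
    rw [injective_iff_map_eq_one]
    intro g hg
    -- A word spelling a kernel element is a relator of the new marking, hence of the old one if the
    -- two points coincide.
    obtain ⟨w, hw⟩ := P.lift_gens_surjective (e.symm g)
    have hmem : w ∈ (P.map φ hφ).relators := by
      rw [P.mem_relators_map, hφ_one, hw, e.apply_symm_apply, hg]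
    rw [MarkedPair.relators_eq_of_mk_eq heq] at hmem
    have h1 : FreeGroup.lift P.gens w = 1 := hmem
    rw [hw] at h1
    simpa using h1

/-! ### Adjoining a letter that commutes with a given element -/

/-- The HNN extension of `G` whose stable letter centralizes `u`. -/
abbrev CentralizingExtension (G : Type*) [Group G] (u : G) : Type _ :=
  HNNExtension G (zpowers u) (zpowers u) (MulEquiv.refl _)

namespace CentralizingExtension

variable {G H : Type*} [Group G] [Group H]

theorem commute_t_of (u : G) :
    Commute (HNNExtension.t : CentralizingExtension G u) (HNNExtension.of u) :=
  HNNExtension.t_mul_of (φ := MulEquiv.refl (zpowers u)) ⟨u, mem_zpowers u⟩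

/-- The homomorphism given by a homomorphism of `G` and an element commuting with the image
of `u`. -/
def lift (u : G) (f : G →* H) (x : H) (hx : Commute x (f u)) : CentralizingExtension G u →* H :=
  HNNExtension.lift f x (by
    rintro ⟨_, k, rfl⟩
    simpa using (hx.zpow_right k).eq)

@[simp]
theorem lift_of (u : G) (f : G →* H) (x : H) (hx : Commute x (f u)) (g : G) :
    lift u f x hx (HNNExtension.of g) = f g :=
  HNNExtension.lift_of _ _ _ _

@[simp]
theorem lift_t (u : G) (f : G →* H) (x : H) (hx : Commute x (f u)) :
    lift u f x hx HNNExtension.t = x :=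
  HNNExtension.lift_t _ _ _

/-- The canonical projection between extensions centralizing `v` and `u`, where `v` is a power
of `u`. -/
def proj {u v : G} (h : v ∈ zpowers u) : CentralizingExtension G v →* CentralizingExtension G u :=
  lift v HNNExtension.of HNNExtension.t (by
    obtain ⟨k, rfl⟩ := h
    simpa using (commute_t_of u).zpow_right k)

@[simp]
theorem proj_of {u v : G} (h : v ∈ zpowers u) (g : G) :
    proj h (HNNExtension.of g) = HNNExtension.of g :=
  lift_of ..

@[simp]
theorem proj_t {u v : G} (h : v ∈ zpowers u) : proj h HNNExtension.t = HNNExtension.t :=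
  lift_t ..

theorem proj_surjective {u v : G} (h : v ∈ zpowers u) : Function.Surjective (proj h) := by
  intro x
  induction x using HNNExtension.induction_on with
  | of g => exact ⟨HNNExtension.of g, proj_of h g⟩
  | t => exact ⟨HNNExtension.t, proj_t h⟩
  | mul x y hx hy =>
    obtain ⟨x, rfl⟩ := hx
    obtain ⟨y, rfl⟩ := hy
    exact ⟨x * y, map_mul _ _ _⟩
  | inv x hx =>
    obtain ⟨x, rfl⟩ := hx
    exact ⟨x⁻¹, map_inv _ _⟩

/-- By Britton's lemma: t x t⁻¹ x⁻¹ is a reduced word when x is outside ⟨v⟩. -/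
theorem not_commute_t_of {v x : G} (hx : x ∉ zpowers v) :
    ¬ Commute (HNNExtension.t : CentralizingExtension G v) (HNNExtension.of x) := by
  intro h
  let w : HNNExtension.NormalWord.ReducedWord G (zpowers v) (zpowers v) :=
    { head := 1
      toList := [(1, x), (-1, x⁻¹)]
      chain := by simpa using fun h => (hx h).elim }
  have hw : w.prod (MulEquiv.refl _) = 1 := by
    simp [w, HNNExtension.NormalWord.ReducedWord.prod, ← mul_assoc, h.eq]
  have := HNNExtension.ReducedWord.toList_eq_nil_of_mem_of_range (MulEquiv.refl _) w
    (by rw [hw]; exact one_mem _)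
  simp [w] at this

theorem proj_not_injective {u v : G} (h : v ∈ zpowers u) (hu : u ∉ zpowers v) :
    ¬ Function.Injective (proj h) := by
  intro hinj
  apply not_commute_t_of hu
  apply hinj
  simpa using (commute_t_of u).eq

/-- If every element outside `⟨v⟩` lies in only finitely many of the subgroups `⟨uᵢ⟩ ≥ ⟨v⟩`, then
every nontrivial element of the extension centralizing `v` is killed by only finitely many of the
projections to the extensions centralizing `uᵢ`. -/
theorem finite_setOf_proj_eq_one {ι : Type*} {u : ι → G} {v : G} (h : ∀ i, v ∈ zpowers (u i))
    (hfin : ∀ g, g ∉ zpowers v → {i | g ∈ zpowers (u i)}.Finite)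
    (x : CentralizingExtension G v) (hx : x ≠ 1) : {i | proj (h i) x = 1}.Finite := by
  obtain ⟨d⟩ := HNNExtension.NormalWord.TransversalPair.nonempty G (zpowers v) (zpowers v)
  obtain ⟨w, rfl⟩ := (HNNExtension.NormalWord.equiv (MulEquiv.refl _) d).symm.surjective x
  -- Only reducedness of the normal form is kept: the same word can then be read over ⟨uᵢ⟩.
  obtain ⟨⟨g, l, hl⟩, _⟩ := w
  change HNNExtension.of g * (l.map _).prod ≠ 1 at hx
  change {i | proj (h i) (HNNExtension.of g * (l.map _).prod) = 1}.Finite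
  -- The word can cease to be reduced over ⟨uᵢ⟩ only if one of its finitely many syllables outside
  -- ⟨v⟩ falls into ⟨uᵢ⟩.
  have hbad : (⋃ p ∈ {p | p ∈ l ∧ p.2 ∉ zpowers v}, {i | p.2 ∈ zpowers (u i)}).Finite :=
    ((List.finite_toSet l).subset fun p hp => hp.1).biUnion fun p hp => hfin p.2 hp.2
  refine hbad.subset fun i hi => ?_
  by_contra hgood
  simp only [Set.mem_iUnion, Set.mem_ofPred_eq, not_exists, and_imp] at hgood
  let w : HNNExtension.NormalWord.ReducedWord G (zpowers (u i)) (zpowers (u i)) :=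
    { head := g
      toList := l
      chain := by
        refine hl.imp_of_mem_imp fun p q hp _ hpq hmem => hpq ?_
        have key : p.2 ∈ zpowers v := by
          by_contra hv
          refine hgood p hp hv ?_
          simpa [HNNExtension.toSubgroup] using hmem
        simpa [HNNExtension.toSubgroup] using key }
  have hw : w.prod (MulEquiv.refl _) = 1 := by
    rw [← hi.out, map_mul, map_list_prod, List.map_map, proj_of]
    simp [w, HNNExtension.NormalWord.ReducedWord.prod, Function.comp_def]
  have hnil : l = [] := HNNExtension.ReducedWord.toList_eq_nil_of_mem_of_range (MulEquiv.refl _) w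
    (by rw [hw]; exact one_mem _)
  subst hnil
  have hg : g = 1 := HNNExtension.of_injective (φ := MulEquiv.refl (zpowers (u i)))
    (by simpa using hi.out)
  exact hx (by simp [hg])

/-- Conjugate elements have isomorphic centralizing extensions. -/
def conjEquiv (u g : G) : CentralizingExtension G u ≃* CentralizingExtension G (conj u g) :=
  MonoidHom.toMulEquiv
    (lift u HNNExtension.of (HNNExtension.of g * HNNExtension.t * (HNNExtension.of g)⁻¹) (by
      have hu : g * conj u g * g⁻¹ = u := by simp [conj, mul_assoc]
      have := (commute_t_of (conj u g)).conj (HNNExtension.of g)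
      rwa [← map_inv, ← map_mul, ← map_mul, hu, map_inv] at this))
    (lift (conj u g) HNNExtension.of
      ((HNNExtension.of g)⁻¹ * HNNExtension.t * HNNExtension.of g) (by
      have := (commute_t_of u).conj (HNNExtension.of g)⁻¹
      simpa [conj, mul_assoc] using this))
    (HNNExtension.hom_ext (by ext; simp) (by simp [mul_assoc]))
    (HNNExtension.hom_ext (by ext; simp) (by simp [mul_assoc]))

end CentralizingExtension

/-! ### The subgroup of `E` generated by `a, b, c, h, s` -/

/-- The relations of `E` that do not involve `t`. -/
structure BaseRelations {G : Type*} [Group G] (a b c h s : G) : Prop where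
  ah : ⁅a, h⁆ = 1
  bh : ⁅b, h⁆ = 1
  ch : ⁅c, h⁆ = 1
  sq : a ^ 2 = 1
  ab : ⁅a, conj a b⁆ = 1
  bc : ⁅b, c⁆ = 1
  ac : conj a c = a * conj a b
  hs : conj (h ^ 2) s = h * a

/-- The five generators other than `t`. -/
inductive BaseGen : Type
  | a | b | c | h | s

/-- The defining relations of `E` that do not involve `t`. -/
def baseRelators : Set (FreeGroup BaseGen) :=
  let a := FreeGroup.of BaseGen.a
  let b := FreeGroup.of BaseGen.b
  let c := FreeGroup.of BaseGen.c
  let h := FreeGroup.of BaseGen.h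
  let s := FreeGroup.of BaseGen.s
  { ⁅a, h⁆, ⁅b, h⁆, ⁅c, h⁆,
    rel (a ^ 2) 1, ⁅a, conj a b⁆, ⁅b, c⁆, rel (conj a c) (a * conj a b),
    rel (conj (h ^ 2) s) (h * a) }

/-- The group with the presentation of `E` without `t`. -/
abbrev Base : Type := PresentedGroup baseRelators

section Naturality

variable {G H : Type*} [Group G] [Group H]

theorem map_conj (f : G →* H) (x y : G) : f (conj x y) = conj (f x) (f y) := by
  simp [conj]

theorem map_rel (f : G →* H) (x y : G) : f (rel x y) = rel (f x) (f y) := by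
  simp [rel]

theorem rel_eq_one_iff {x y : G} : rel x y = 1 ↔ x = y :=
  mul_inv_eq_one

theorem BaseRelations.map {a b c h s : G} (hr : BaseRelations a b c h s) (f : G →* H) :
    BaseRelations (f a) (f b) (f c) (f h) (f s) := by
  constructor
  · rw [← map_commutatorElement, hr.ah, map_one]
  · rw [← map_commutatorElement, hr.bh, map_one]
  · rw [← map_commutatorElement, hr.ch, map_one]
  · rw [← map_pow, hr.sq, map_one]
  · rw [← map_conj, ← map_commutatorElement, hr.ab, map_one]
  · rw [← map_commutatorElement, hr.bc, map_one]
  · rw [← map_conj, ← map_conj, hr.ac, map_mul]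
  · rw [← map_pow, ← map_conj, hr.hs, map_mul]

end Naturality

namespace Base

/-- The generator `a`. -/
def a : Base := PresentedGroup.of BaseGen.a
/-- The generator `b`. -/
def b : Base := PresentedGroup.of BaseGen.b
/-- The generator `c`. -/
def c : Base := PresentedGroup.of BaseGen.c
/-- The generator `h`. -/
def h : Base := PresentedGroup.of BaseGen.h
/-- The generator `s`. -/
def s : Base := PresentedGroup.of BaseGen.s

theorem forall_relators_iff {G : Type*} [Group G] (f : FreeGroup BaseGen →* G) :
    (∀ w ∈ baseRelators, f w = 1) ↔
      BaseRelations (f (.of .a)) (f (.of .b)) (f (.of .c)) (f (.of .h)) (f (.of .s)) := by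
  simp only [baseRelators, Set.mem_insert_iff, Set.mem_singleton_iff, forall_eq_or_imp, forall_eq,
    map_rel, map_conj, map_commutatorElement, map_mul, map_pow, map_one, rel_eq_one_iff]
  exact ⟨fun ⟨h₁, h₂, h₃, h₄, h₅, h₆, h₇, h₈⟩ => ⟨h₁, h₂, h₃, h₄, h₅, h₆, h₇, h₈⟩,
    fun hr => ⟨hr.ah, hr.bh, hr.ch, hr.sq, hr.ab, hr.bc, hr.ac, hr.hs⟩⟩

theorem relations : BaseRelations a b c h s :=
  (forall_relators_iff (PresentedGroup.mk baseRelators)).mp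
    fun _ hw => PresentedGroup.one_of_mem hw

/-- The images of the generators under a prospective homomorphism. -/
def genMap {G : Type*} (a b c h s : G) : BaseGen → G
  | .a => a
  | .b => b
  | .c => c
  | .h => h
  | .s => s

/-- The homomorphism given by a tuple satisfying the relations. -/
def lift {G : Type*} [Group G] {a b c h s : G} (hr : BaseRelations a b c h s) : Base →* G :=
  PresentedGroup.toGroup (f := genMap a b c h s) (by
    simpa [forall_relators_iff, genMap] using hr)

section Lift

variable {G : Type*} [Group G] {x y z u v : G} (hr : BaseRelations x y z u v)

@[simp]
theorem lift_a : lift hr a = x := PresentedGroup.toGroup.of _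
@[simp]
theorem lift_b : lift hr b = y := PresentedGroup.toGroup.of _
@[simp]
theorem lift_c : lift hr c = z := PresentedGroup.toGroup.of _
@[simp]
theorem lift_h : lift hr h = u := PresentedGroup.toGroup.of _
@[simp]
theorem lift_s : lift hr s = v := PresentedGroup.toGroup.of _

theorem hom_ext {f g : Base →* G} (ha : f a = g a) (hb : f b = g b) (hc : f c = g c)
    (hh : f h = g h) (hs : f s = g s) : f = g := by
  refine PresentedGroup.ext fun i => ?_
  cases i
  exacts [ha, hb, hc, hh, hs]

end Lift

end Base

/-! ### A linear model separating the conjugates of `a` -/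

section Model

/-- The field `𝔽₂(X)`. -/
abbrev ModelField : Type := RatFunc (ZMod 2)

theorem modelX_ne_zero : (RatFunc.X : ModelField) ≠ 0 := RatFunc.X_ne_zero

theorem one_add_modelX_ne_zero : (1 + RatFunc.X : ModelField) ≠ 0 := by
  have h := RatFunc.algebraMap_ne_zero (Polynomial.X_add_C_ne_zero (1 : ZMod 2))
  simpa [add_comm] using h

theorem modelX_pow_injective : Function.Injective fun i : ℕ => (RatFunc.X : ModelField) ^ i := by
  intro i j hij
  have h : (Polynomial.X : Polynomial (ZMod 2)) ^ i = Polynomial.X ^ j :=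
    RatFunc.algebraMap_injective (ZMod 2) (by simpa using hij)
  simpa using congrArg Polynomial.natDegree h

/-- The translation by `y` together with `k ∈ ℤ`. -/
noncomputable def modelTranslation (y : ModelField) (k : ℤ) :
    Equiv.Perm ModelField × Multiplicative ℤ := (Equiv.addRight y, Multiplicative.ofAdd k)

/-- The homothety `z ↦ y⁻¹ z`. -/
noncomputable def modelHomothety (y : ModelField) (hy : y ≠ 0) :
    Equiv.Perm ModelField × Multiplicative ℤ := ((Equiv.mulRight₀ y hy)⁻¹, 1)

theorem modelTranslation_mul (y z : ModelField) (k l : ℤ) :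
    modelTranslation y k * modelTranslation z l = modelTranslation (y + z) (k + l) := by
  refine Prod.ext (Equiv.ext fun w => ?_) rfl
  simp [modelTranslation, add_comm, add_left_comm]

theorem modelTranslation_injective {y z : ModelField} {k l : ℤ}
    (h : modelTranslation y k = modelTranslation z l) : y = z ∧ k = l := by
  refine ⟨?_, congrArg (fun p => p.2.toAdd) h⟩
  have := congrArg (fun p => p.1 0) h
  simpa [modelTranslation] using this

theorem modelTranslation_zero_zero : modelTranslation 0 0 = 1 := by
  refine Prod.ext (Equiv.ext fun w => ?_) rfl
  simp [modelTranslation]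

theorem modelTranslation_zpow (y : ModelField) (k m : ℤ) :
    modelTranslation y k ^ m = modelTranslation (m * y) (m * k) := by
  induction m using Int.induction_on with
  | zero => simp [modelTranslation_zero_zero]
  | succ i ih =>
    rw [zpow_add_one, ih, modelTranslation_mul]
    push_cast
    ring_nf
  | pred i ih =>
    rw [zpow_sub_one, ih, mul_inv_eq_iff_eq_mul, modelTranslation_mul]
    push_cast
    ring_nf

/-- Permutations compose from right to left and `conj x y` is y⁻¹xy; the inverse in `modelHomothety`
is there so that conjugation multiplies by z and not by z⁻¹. -/
theorem conj_modelTranslation_modelHomothety (y z : ModelField) (hz : z ≠ 0) (k : ℤ) :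
    conj (modelTranslation y k) (modelHomothety z hz) = modelTranslation (y * z) k := by
  refine Prod.ext (Equiv.ext fun w => ?_) ?_
  · simp [modelTranslation, modelHomothety, conj, add_mul, hz]
  · simp [modelTranslation, modelHomothety, conj]

/-- The factor ℤ gives the images of h² and ha infinite order, so that a stable letter can conjugate
one to the other. -/
theorem orderOf_modelTranslation (y : ModelField) {k : ℤ} (hk : k ≠ 0) :
    orderOf (modelTranslation y k) = 0 := by
  rw [orderOf_eq_zero_iff']
  intro n hn h
  rw [← zpow_natCast, modelTranslation_zpow, ← modelTranslation_zero_zero] at h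
  have := (modelTranslation_injective h).2
  simp [hk, hn.ne'] at this

/-- The isomorphism between the infinite cyclic subgroups generated by two translations. -/
noncomputable def modelEquiv :
    zpowers (modelTranslation 1 1) ≃* zpowers (modelTranslation 0 2) :=
  mulEquivOfOrderOfEq (g := ⟨modelTranslation 1 1, mem_zpowers _⟩)
    (g' := ⟨modelTranslation 0 2, mem_zpowers _⟩)
    (by rintro ⟨_, k, rfl⟩; exact ⟨k, rfl⟩) (by rintro ⟨_, k, rfl⟩; exact ⟨k, rfl⟩)
    (by
      rw [orderOf_mk, orderOf_mk, orderOf_modelTranslation _ one_ne_zero,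
        orderOf_modelTranslation _ two_ne_zero])

/-- The HNN extension of the model in which `h ^ 2` and `h * a` are conjugate. -/
abbrev Model : Type := HNNExtension _ _ _ modelEquiv

/-- The embedding of the group of affine transformations into the HNN extension. -/
noncomputable abbrev modelOf : Equiv.Perm ModelField × Multiplicative ℤ →* Model := HNNExtension.of

/-- The stable letter satisfies t g t⁻¹ = φ(g), which is why `modelEquiv` runs from ⟨ha⟩ to ⟨h²⟩. -/
theorem conj_modelTranslation_t :
    conj (modelOf (modelTranslation 0 2)) HNNExtension.t = modelOf (modelTranslation 1 1) := by
  have h : modelEquiv ⟨modelTranslation 1 1, mem_zpowers _⟩ =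
      ⟨modelTranslation 0 2, mem_zpowers _⟩ := mulEquivOfOrderOfEq_apply_gen ..
  have := HNNExtension.equiv_eq_conj (φ := modelEquiv) ⟨modelTranslation 1 1, mem_zpowers _⟩
  rw [h] at this
  rw [conj, modelOf, this]
  group

/-- Here a is translation by 1, while b and c scale translations by X and 1 + X under conjugation.
Thus a² = 1 is characteristic 2, and both sides of the relation for `conj a c` are translation by 1
+ X. -/
theorem model_relations : BaseRelations (modelOf (modelTranslation 1 0))
    (modelOf (modelHomothety _ modelX_ne_zero)) (modelOf (modelHomothety _ one_add_modelX_ne_zero))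
    (modelOf (modelTranslation 0 1)) HNNExtension.t := by
  have hcomm : ∀ (y : ModelField) (hy : y ≠ 0),
      ⁅modelHomothety y hy, modelTranslation 0 1⁆ = 1 := by
    intro y hy
    rw [commutatorElement_eq_one_iff_mul_comm]
    refine Prod.ext (Equiv.ext fun w => ?_) ?_
    · simp [modelTranslation, modelHomothety]
    · simp [modelTranslation, modelHomothety]
  constructor
  · rw [← map_commutatorElement, commutatorElement_eq_one_iff_mul_comm.mpr, map_one]
    simp [modelTranslation_mul]
  · rw [← map_commutatorElement, hcomm, map_one]
  · rw [← map_commutatorElement, hcomm, map_one]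
  · rw [← map_pow, pow_two, modelTranslation_mul, CharTwo.add_self_eq_zero, add_zero,
      modelTranslation_zero_zero, map_one]
  · rw [← map_conj, conj_modelTranslation_modelHomothety, ← map_commutatorElement,
      commutatorElement_eq_one_iff_mul_comm.mpr, map_one]
    simp [modelTranslation_mul, add_comm]
  · rw [← map_commutatorElement, commutatorElement_eq_one_iff_mul_comm.mpr, map_one]
    refine Prod.ext (Equiv.ext fun w => ?_) ?_
    · simp [modelHomothety, mul_right_comm]
    · simp [modelHomothety]
  · rw [← map_conj, ← map_conj, conj_modelTranslation_modelHomothety,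
      conj_modelTranslation_modelHomothety, ← map_mul, modelTranslation_mul]
    simp
  · rw [← map_pow, pow_two, modelTranslation_mul, ← map_mul, modelTranslation_mul]
    simpa using conj_modelTranslation_t

end Model

/-! ### The square roots of h² in the base group -/

namespace Base

/-- The representation of the base group in the model. -/
noncomputable def toModel : Base →* Model := lift model_relations

/-- The square roots `h * a ^ (b ^ i)` of `h ^ 2`. -/
def root (i : ℕ) : Base := h * conj a (b ^ i)

theorem conj_a_sq (x : Base) : conj a x ^ 2 = 1 := by
  have := relations.sq
  rw [pow_two] at this ⊢
  calc conj a x * conj a x = x⁻¹ * (a * a) * x := by simp [conj, mul_assoc]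
    _ = 1 := by simp [this]

theorem conj_h_sq (i : ℕ) : conj (h ^ 2) (s * b ^ i) = root i := by
  have hb : Commute (b ^ i) h :=
    (commutatorElement_eq_one_iff_commute.mp relations.bh).pow_left i
  have hs := relations.hs
  calc conj (h ^ 2) (s * b ^ i) = conj (conj (h ^ 2) s) (b ^ i) := by simp [conj, mul_assoc]
    _ = conj (h * a) (b ^ i) := by rw [hs]
    _ = root i := by
      rw [root, conj, conj, ← mul_assoc, hb.inv_left.eq]
      simp only [mul_assoc]

theorem commute_h_conj (i : ℕ) : Commute h (conj a (b ^ i)) := by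
  have hb : Commute h (b ^ i) :=
    ((commutatorElement_eq_one_iff_commute.mp relations.bh).pow_left i).symm
  have ha : Commute h a := (commutatorElement_eq_one_iff_commute.mp relations.ah).symm
  exact (hb.inv_right.mul_right ha).mul_right hb

theorem root_sq (i : ℕ) : root i ^ 2 = h ^ 2 := by
  rw [root, (commute_h_conj i).mul_pow, conj_a_sq, mul_one]

theorem toModel_conj_a (i : ℕ) :
    toModel (conj a (b ^ i)) = modelOf (modelTranslation (RatFunc.X ^ i) 0) := by
  induction i with
  | zero => simp [toModel, conj]
  | succ i ih =>
    have : conj a (b ^ (i + 1)) = conj (conj a (b ^ i)) b := by simp [conj, pow_succ, mul_assoc]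
    rw [this, map_conj, ih, toModel, lift_b, ← map_conj, conj_modelTranslation_modelHomothety,
      pow_succ]

theorem toModel_root (i : ℕ) :
    toModel (root i) = modelOf (modelTranslation (RatFunc.X ^ i) 1) := by
  rw [root, map_mul, toModel_conj_a, toModel, lift_h, ← map_mul, modelTranslation_mul, zero_add,
    add_zero]

theorem h_sq_mem_zpowers_root (i : ℕ) : h ^ 2 ∈ zpowers (root i) :=
  ⟨2, by simpa using root_sq i⟩

/-- The ℤ-coordinate in the model is 1 for the root and even for powers of h². -/
theorem root_notMem_zpowers (i : ℕ) : root i ∉ zpowers (h ^ 2) := by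
  rintro ⟨k, hk⟩
  have := congrArg toModel hk
  dsimp only at this
  rw [toModel_root, map_zpow, map_pow, toModel, lift_h, ← zpow_natCast, ← zpow_mul, ← map_zpow,
    modelTranslation_zpow] at this
  have := (modelTranslation_injective (HNNExtension.of_injective modelEquiv this)).2
  push_cast at this
  omega

/-- Write g as the k-th power of one root and the l-th of the other. The ℤ-coordinates in the model
give k = l. An even k would put g in ⟨h²⟩; for odd k, characteristic 2 reduces the translation parts
to Xⁱ = Xʲ. -/
theorem eq_of_mem_zpowers_root {g : Base} (hg : g ∉ zpowers (h ^ 2)) {i j : ℕ}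
    (hi : g ∈ zpowers (root i)) (hj : g ∈ zpowers (root j)) : i = j := by
  obtain ⟨k, hk⟩ := hi
  obtain ⟨l, hl⟩ := hj
  dsimp only at hk hl
  have hmodel := congrArg toModel (hk.trans hl.symm)
  rw [map_zpow, map_zpow, toModel_root, toModel_root, ← map_zpow, ← map_zpow,
    modelTranslation_zpow, modelTranslation_zpow] at hmodel
  obtain ⟨h₁, h₂⟩ := modelTranslation_injective (HNNExtension.of_injective modelEquiv hmodel)
  rcases Int.even_or_odd' k with ⟨m, rfl | rfl⟩
  · refine (hg ⟨m, ?_⟩).elim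
    dsimp only
    rw [← hk, zpow_mul, zpow_ofNat, root_sq]
  · obtain rfl : l = 2 * m + 1 := by omega
    have hodd : ((2 * m + 1 : ℤ) : ModelField) = 1 := by
      have h2 : (2 : ModelField) = 0 := CharTwo.two_eq_zero
      push_cast
      rw [h2, zero_mul, zero_add]
    rw [hodd, one_mul, one_mul] at h₁
    exact modelX_pow_injective h₁

end Base

/-! ### The group `E` is condensed -/

/-- The images of the generators of `E` under a prospective homomorphism. -/
def genMap {G : Type*} (a b c h s t : G) : Gen → G
  | .a => a
  | .b => b
  | .c => c
  | .h => h
  | .s => s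
  | .t => t

theorem E.forall_relators_iff {G : Type*} [Group G] (f : FreeGroup Gen →* G) :
    (∀ w ∈ relatorsE, f w = 1) ↔
      BaseRelations (f (.of .a)) (f (.of .b)) (f (.of .c)) (f (.of .h)) (f (.of .s)) ∧
        conj (f (.of .h) ^ 2) (f (.of .t)) = f (.of .h) ^ 2 := by
  simp only [relatorsE, Set.mem_insert_iff, Set.mem_singleton_iff, forall_eq_or_imp, forall_eq,
    map_rel, map_conj, map_commutatorElement, map_mul, map_pow, map_one, rel_eq_one_iff]
  exact ⟨fun ⟨h₁, h₂, h₃, h₄, h₅, h₆, h₇, h₈, h₉⟩ => ⟨⟨h₁, h₂, h₃, h₄, h₅, h₆, h₇, h₈⟩, h₉⟩,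
    fun ⟨hr, ht⟩ => ⟨hr.ah, hr.bh, hr.ch, hr.sq, hr.ab, hr.bc, hr.ac, hr.hs, ht⟩⟩

theorem E.relations : BaseRelations (PresentedGroup.of Gen.a : E) (PresentedGroup.of Gen.b)
      (PresentedGroup.of Gen.c) (PresentedGroup.of Gen.h) (PresentedGroup.of Gen.s) ∧
    conj ((PresentedGroup.of Gen.h : E) ^ 2) (PresentedGroup.of Gen.t) =
      PresentedGroup.of Gen.h ^ 2 :=
  (E.forall_relators_iff (PresentedGroup.mk relatorsE)).mp fun _ hw => PresentedGroup.one_of_mem hw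

theorem conj_eq_self_iff {G : Type*} [Group G] {x y : G} : conj x y = x ↔ Commute y x := by
  rw [conj, mul_assoc, inv_mul_eq_iff_eq_mul]
  exact eq_comm

/-- The homomorphism from `E` given by a tuple satisfying the relations. -/
def E.lift {G : Type*} [Group G] {a b c h s t : G} (hr : BaseRelations a b c h s)
    (ht : conj (h ^ 2) t = h ^ 2) : E →* G :=
  PresentedGroup.toGroup (f := genMap a b c h s t) (by
    simpa [E.forall_relators_iff, genMap] using And.intro hr ht)

theorem E.lift_of {G : Type*} [Group G] {a b c h s t : G} (hr : BaseRelations a b c h s)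
    (ht : conj (h ^ 2) t = h ^ 2) (x : Gen) :
    E.lift hr ht (PresentedGroup.of x) = genMap a b c h s t x :=
  PresentedGroup.toGroup.of _

/-- The group `E` is the extension of the base group by a letter centralizing `h ^ 2`. -/
def E.equivCentralizingExtension : E ≃* CentralizingExtension Base (Base.h ^ 2) :=
  MonoidHom.toMulEquiv
    (E.lift (Base.relations.map HNNExtension.of) (t := HNNExtension.t) (by
      rw [conj_eq_self_iff, ← map_pow]
      exact CentralizingExtension.commute_t_of _))
    (CentralizingExtension.lift _ (Base.lift E.relations.1) (PresentedGroup.of Gen.t) (by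
      rw [map_pow, Base.lift_h, ← conj_eq_self_iff]
      exact E.relations.2))
    (PresentedGroup.ext fun x => by
      cases x <;> simp [E.lift_of, genMap])
    (HNNExtension.hom_ext
      (Base.hom_ext (by simp [E.lift_of, genMap]) (by simp [E.lift_of, genMap])
        (by simp [E.lift_of, genMap]) (by simp [E.lift_of, genMap]) (by simp [E.lift_of, genMap]))
      (by simp [E.lift_of, genMap]))

theorem E.exists_surjective_endomorphism (S : Set E) (hS : S.Finite) (h1 : 1 ∉ S) :
    ∃ f : E →* E, Function.Surjective f ∧ ¬ Function.Injective f ∧ ∀ g ∈ S, f g ≠ 1 := by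
  let e := E.equivCentralizingExtension
  have hbad : (⋃ g ∈ S, {i | CentralizingExtension.proj (Base.h_sq_mem_zpowers_root i) (e g) = 1}
      ).Finite := by
    refine hS.biUnion fun g hg => CentralizingExtension.finite_setOf_proj_eq_one
      Base.h_sq_mem_zpowers_root (fun x hx => Set.Subsingleton.finite fun i hi j hj =>
        Base.eq_of_mem_zpowers_root hx hi hj) _ ?_
    rw [Ne, EmbeddingLike.map_eq_one_iff]
    rintro rfl
    exact h1 hg
  obtain ⟨i, hi⟩ := hbad.exists_notMem
  simp only [Set.mem_iUnion, Set.mem_ofPred_eq, not_exists] at hi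
  -- Conjugation by s·bⁱ carries h² to the i-th root; the cast only rewrites this conjugate as `root
  -- i`.
  let ε : CentralizingExtension Base (Base.root i) ≃* E :=
    ((CentralizingExtension.conjEquiv (Base.h ^ 2) (Base.s * Base.b ^ i)).trans
      (Base.conj_h_sq i ▸ MulEquiv.refl _)).symm.trans e.symm
  let p := CentralizingExtension.proj (Base.h_sq_mem_zpowers_root i)
  refine ⟨(ε.toMonoidHom.comp p).comp e.toMonoidHom,
    (ε.surjective.comp (CentralizingExtension.proj_surjective _)).comp e.surjective, ?_, ?_⟩
  · intro hinj
    refine CentralizingExtension.proj_not_injective (Base.h_sq_mem_zpowers_root i)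
      (Base.root_notMem_zpowers i) fun x y hxy => e.symm.injective (hinj ?_)
    change ε (p (e (e.symm x))) = ε (p (e (e.symm y)))
    rw [e.apply_symm_apply, e.apply_symm_apply, hxy]
  · intro g hg h
    refine hi g hg (ε.injective ?_)
    rw [map_one]
    exact h

instance : Finite Gen :=
  Finite.of_surjective (![Gen.a, Gen.b, Gen.c, Gen.h, Gen.s, Gen.t]) (by
    rintro (_ | _ | _ | _ | _ | _)
    exacts [⟨0, rfl⟩, ⟨1, rfl⟩, ⟨2, rfl⟩, ⟨3, rfl⟩, ⟨4, rfl⟩, ⟨5, rfl⟩])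

theorem finite_relatorsE : relatorsE.Finite := by
  simp [relatorsE]

end CondensedGroups

theorem mainTheorem3 :
    Group.IsFinitelyPresented CondensedGroups.E ∧
      CondensedGroups.IsCondensed CondensedGroups.E := by
  have : Finite CondensedGroups.relatorsE := CondensedGroups.finite_relatorsE
  refine ⟨inferInstance, CondensedGroups.isCondensed_of_surjective_endomorphisms _ ?_
    CondensedGroups.E.exists_surjective_endomorphism⟩
  exact Group.fg_of_surjective (PresentedGroup.mk_surjective CondensedGroups.relatorsE)
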